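/- Let $(\ell_k)_{k\in\mathbb N_0}\subseteq\mathbb N=\{1,2,\dots\}$, $L\in\mathbb N$, $\mathbf d_k=\sum_{n=1}^{k}\ell_n(\ell_{n-1}+1)$ and $\mathfrak d=\mathbf d_L$. For $\theta\in\mathbb R^{\mathfrak d}$, $k\in\{1,\dots,L\}$, $i\in\{1,\dots,\ell_k\}$, $j\in\{1,\dots,\ell_{k-1}\}$ let $$\mathfrak w^{k,\theta}_{i,j}=\theta_{(i-1)\ell_{k-1}+j+\mathbf d_{k-1}},\qquad \mathfrak b^{k,\theta}_i=\theta_{\ell_k\ell_{k-1}+i+\mathbf d_{k-1}}.$$ Let $S\subseteq\mathbb R$ be finite and let $\mathbf g\colon S\to\mathbb R$ and $A_n\colon\mathbb R\to\mathbb R$, $n\in\mathbb N_0$, be functions such that $A_n\in C^1(\mathbb R,\mathbb R)$ for all $n\ge 1$ and $A_0|_{\mathbb R\setminus S}\in C^1(\mathbb R\setminus S,\mathbb R)$. Let $a\colon\mathbb R\to\mathbb R$ be given by $a(x)=(A_0)'(x)$ for $x\notin S$ and $a(x)=\mathbf g(x)$ for $x\in S$. Assume (1) for every $x\in\mathbb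 R$ there is $m\in\mathbb N$ such that $A_n(x)=A_0(x)$ and $(A_n)'(x)=a(x)$ for all $n\ge m$; (2) for every $m\in\mathbb N$ it holds that $\sup_{n\in\mathbb N}\sup_{x\in[-m,m]}\bigl(|A_n(x)|+|(A_n)'(x)|\bigr)<\infty$; (3) $\min_{z\in\{-1,1\}}\sum_{x\in S}\limsup_{h\searrow0}|a(x+zh)-a(x)|=0$. For $n\in\mathbb N_0$, $\theta\in\mathbb R^{\mathfrak d}$ let $\mathcal N_n^{k,\theta}\colon\mathbb R^{\ell_0}\to\mathbb R^{\ell_k}$, $k\in\{1,\dots,L\}$, be given by $\mathcal N^{1,\theta}_{n,i}(x)=\mathfrak b^{1,\theta}_i+\sum_{j=1}^{\ell_0}\mathfrak w^{1,\theta}_{i,j}x_j$ and $\mathcal N^{k+1,\theta}_{n,i}(x)=\mathfrak b^{k+1,\theta}_i+\sum_{j=1}^{\ell_k}\mathfrak w^{k+1,\theta}_{i,j}A_n(\mathcal N^{k,\theta}_{n,j}(x))$ for $1\le k<L$. Let $\mu$ be a finite Borel measure on $\mathbb R^{\ell_0}\times\mathbb R^{\ell_L}$ such that $\{x\in\mathbb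 R^{\ell_0}\colon\exists\,y\in\mathbb R^{\ell_L}\colon(x,y)\in\operatorname{supp}(\mu)\}$ is bounded. Let $H\in C^1(\mathbb R^{\ell_L}\times\mathbb R^{\mathfrak d}\times\mathbb R^{\ell_L},\mathbb R)$, $(z,\theta,y)\mapsto H(z,\theta,y)$, be such that $\int|H(\mathcal N_n^{L,\theta}(x),\theta,y)|\,\mu(\mathrm dx,\mathrm dy)<\infty$ for all $n\in\mathbb N_0$, $\theta\in\mathbb R^{\mathfrak d}$, and such that for all $r\in(0,\infty)$, $X\in[-r,r]^{\ell_L}$, $\Theta\in[-r,r]^{\mathfrak d}$ there is $C\in\mathbb R$ such that for all $z\in[-r,r]^{\ell_L}$, $\theta\in[-r,r]^{\mathfrak d}$, $(x,y)\in\operatorname{supp}(\mu)$ $$\frac{\|\nabla_zH(z,\theta,y)\|+\|\nabla_\theta H(z,\theta,y)\|}{1+|H(X,\Theta,y)|}\le C.$$ For $n\in\mathbb N_0$ let $\mathcal L_n\colon\mathbb R^{\mathfrak d}\to\mathbb R$ be given by $\mathcal L_n(\theta)=\int H(\mathcal N_n^{L,\theta}(x),\theta,y)\,\mu(\mathrm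 dx,\mathrm dy)$, and let $\mathcal G\colon\mathbb R^{\mathfrak d}\to\mathbb R^{\mathfrak d}$ satisfy $\mathcal G(\theta)=\lim_{n\to\infty}(\nabla\mathcal L_n)(\theta)$ for every $\theta$ at which the gradients $(\nabla\mathcal L_n)(\theta)$, $n\in\mathbb N$, exist and converge. Then for every open $U\subseteq\mathbb R^{\mathfrak d}$ with $\mathcal L_0|_U\in C^1(U,\mathbb R)$ and every $\theta\in U$ it holds that $\mathcal G(\theta)=(\nabla\mathcal L_0)(\theta)$. -/

import Mathlib

open MeasureTheory Filter Topology

noncomputable section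

namespace ANN

/-- The generalized derivative of `f` on the real line: it is the prescribed value `γ x` at the
points `x` of the finite exceptional set `S`, and the usual derivative of `f` elsewhere. -/
def genDeriv (S : Finset ℝ) (γ : S → ℝ) (f : ℝ → ℝ) (x : ℝ) : ℝ :=
  if h : x ∈ S then γ ⟨x, h⟩ else deriv f x

/-- `∑_{x ∈ S} limsup_{h ↘ 0} |a (x + z h) - a x|`, as an element of `[0, ∞]`. -/
def oneSidedJump (S : Finset ℝ) (a : ℝ → ℝ) (z : ℝ) : ENNReal :=
  ∑ x ∈ S, limsup (fun h : ℝ => ENNReal.ofReal |a (x + z * h) - a x|) (𝓝[>] (0 : ℝ))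

/-- Number of parameters of the first `k` affine layers of a network with layer widths
`ℓ 0, ℓ 1, ℓ 2, …`, that is `∑_{n=1}^k ℓ n * (ℓ (n-1) + 1)`. -/
def paramDim (ℓ : ℕ → ℕ) (k : ℕ) : ℕ :=
  ∑ n ∈ Finset.range k, ℓ (n + 1) * (ℓ n + 1)

/-- The coordinate of the parameter vector with (zero-based) number `m`. -/
def coord {d : ℕ} (θ : EuclideanSpace ℝ (Fin d)) (m : ℕ) : ℝ :=
  if h : m < d then θ ⟨m, h⟩ else 0

/-- Entry `(i, j)` of the weight matrix of the affine map from layer `k` to layer `k + 1`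
(all indices are zero-based). -/
def weight (ℓ : ℕ → ℕ) {d : ℕ} (θ : EuclideanSpace ℝ (Fin d)) (k : ℕ)
    (i : Fin (ℓ (k + 1))) (j : Fin (ℓ k)) : ℝ :=
  coord θ (i * ℓ k + j + paramDim ℓ k)

/-- Entry `i` of the bias vector of the affine map from layer `k` to layer `k + 1`
(all indices are zero-based). -/
def bias (ℓ : ℕ → ℕ) {d : ℕ} (θ : EuclideanSpace ℝ (Fin d)) (k : ℕ)
    (i : Fin (ℓ (k + 1))) : ℝ :=
  coord θ (ℓ (k + 1) * ℓ k + i + paramDim ℓ k)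

/-- The parameters of the first `L` affine maps are genuine coordinates of a vector of
`paramDim ℓ L` entries, so the default value in `coord` is not used for them. -/
theorem bias_index_lt (ℓ : ℕ → ℕ) {k L : ℕ} (hk : k < L) (i : Fin (ℓ (k + 1))) :
    ℓ (k + 1) * ℓ k + i + paramDim ℓ k < paramDim ℓ L := by
  have h1 : paramDim ℓ (k + 1) ≤ paramDim ℓ L :=
    Finset.sum_le_sum_of_subset (Finset.range_mono hk)
  have h2 : paramDim ℓ (k + 1) = paramDim ℓ k + ℓ (k + 1) * (ℓ k + 1) :=
    Finset.sum_range_succ _ _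
  have h3 := i.isLt
  rw [mul_add, mul_one] at h2
  omega

theorem weight_index_lt (ℓ : ℕ → ℕ) {k L : ℕ} (hk : k < L) (i : Fin (ℓ (k + 1)))
    (j : Fin (ℓ k)) : i * ℓ k + j + paramDim ℓ k < paramDim ℓ L := by
  have h1 := bias_index_lt ℓ hk i
  have h2 := j.isLt
  have h3 : ((i : ℕ) + 1) * ℓ k ≤ ℓ (k + 1) * ℓ k := Nat.mul_le_mul_right _ i.isLt
  rw [add_mul, one_mul] at h3
  omega

/-- The affine map from layer `k` to layer `k + 1`. -/
def affineLayer (ℓ : ℕ → ℕ) {d : ℕ} (θ : EuclideanSpace ℝ (Fin d)) (k : ℕ)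
    (v : Fin (ℓ k) → ℝ) (i : Fin (ℓ (k + 1))) : ℝ :=
  bias ℓ θ k i + ∑ j, weight ℓ θ k i j * v j

/-- The preactivations in layer `k` of the fully connected feedforward network with layer widths
`ℓ`, activation `A` and parameters `θ` on input `x`. The activation is applied in the hidden layers
only: it is applied neither to the input nor after the last affine map. -/
def preact (ℓ : ℕ → ℕ) {d : ℕ} (A : ℝ → ℝ) (θ : EuclideanSpace ℝ (Fin d))
    (x : EuclideanSpace ℝ (Fin (ℓ 0))) : (k : ℕ) → Fin (ℓ k) → ℝ
  | 0 => fun i => x i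
  | 1 => affineLayer ℓ θ 0 (fun j => x j)
  | k + 2 => affineLayer ℓ θ (k + 1) (fun j => A (preact ℓ A θ x (k + 1) j))

/-- The realization function of the network with `L` affine layers. -/
def realization (ℓ : ℕ → ℕ) (L : ℕ) (A : ℝ → ℝ) (θ : EuclideanSpace ℝ (Fin (paramDim ℓ L)))
    (x : EuclideanSpace ℝ (Fin (ℓ 0))) : EuclideanSpace ℝ (Fin (ℓ L)) :=
  WithLp.toLp 2 (preact ℓ A θ x L)

/-- The objective function `θ ↦ ∫ H(N^{L,θ}(x), θ, y) μ(dx, dy)`. -/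
def risk (ℓ : ℕ → ℕ) (L : ℕ)
    (H : EuclideanSpace ℝ (Fin (ℓ L)) × EuclideanSpace ℝ (Fin (paramDim ℓ L)) ×
      EuclideanSpace ℝ (Fin (ℓ L)) → ℝ)
    (μ : Measure (EuclideanSpace ℝ (Fin (ℓ 0)) × EuclideanSpace ℝ (Fin (ℓ L))))
    (A : ℝ → ℝ) (θ : EuclideanSpace ℝ (Fin (paramDim ℓ L))) : ℝ :=
  ∫ p, H (realization ℓ L A θ p.1, θ, p.2) ∂μ

end ANN

end

/-! Replacing the derivative of the activation by `a` in the chain rule gives a formal derivative of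
the integrand, `lossDeriv`. Its integral with activation `A 0` equals both sides of the claim.

For `G`: at fixed parameters and input only finitely many activation values occur, so for large `n`
the true derivative for `A n` equals the formal one up to continuity of `H'`. A Lipschitz constant
integrable in the data and independent of `n` (`exists_loss_lipschitz`) allows dominated
convergence.

For the gradient of the risk of `A 0`: differentiation under the integral may fail at `θ`, since
preactivations can sit on kinks with positive mass. It works at parameters whose hidden
preactivations almost surely avoid `S` (`hasFDerivAt_risk`). Such parameters exist arbitrarily close
to `θ`, with every hidden preactivation moved strictly to the side on which `a` is one-sidedly
continuous (`exists_generic_perturbation`). Along them the formal derivatives converge to the one at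
`θ`, while C¹ regularity makes the true gradients converge to the gradient at `θ`; hence the two
agree. -/

namespace ANN

/-! ### Layers: formal derivatives, continuity and limits -/

/-- The `m`-th coordinate as a continuous linear functional, zero if `m` is out of range. -/
noncomputable def coordL (d m : ℕ) : EuclideanSpace ℝ (Fin d) →L[ℝ] ℝ :=
  if h : m < d then EuclideanSpace.proj ⟨m, h⟩ else 0

theorem coord_eq_coordL {d : ℕ} (θ : EuclideanSpace ℝ (Fin d)) (m : ℕ) :
    coord θ m = coordL d m θ := by
  unfold coord coordL
  split_ifs <;> simp

theorem abs_apply_le_norm {d : ℕ} (θ : EuclideanSpace ℝ (Fin d)) (i : Fin d) : |θ i| ≤ ‖θ‖ := by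
  simpa using PiLp.norm_apply_le θ i

theorem abs_coord_le {d : ℕ} (θ : EuclideanSpace ℝ (Fin d)) (m : ℕ) : |coord θ m| ≤ ‖θ‖ := by
  unfold coord
  split_ifs
  · exact abs_apply_le_norm _ _
  · simp

theorem coord_sub {d : ℕ} (θ θ' : EuclideanSpace ℝ (Fin d)) (m : ℕ) :
    coord (θ - θ') m = coord θ m - coord θ' m := by
  simp [coord_eq_coordL]

theorem abs_coord_sub_le {d : ℕ} (θ θ' : EuclideanSpace ℝ (Fin d)) (m : ℕ) :
    |coord θ m - coord θ' m| ≤ ‖θ - θ'‖ := by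
  rw [← coord_sub]
  exact abs_coord_le _ _

theorem continuous_coord {d : ℕ} (m : ℕ) :
    Continuous fun θ : EuclideanSpace ℝ (Fin d) => coord θ m := by
  simp only [coord_eq_coordL]
  exact (coordL d m).continuous

theorem hasFDerivAt_coord {d : ℕ} (θ : EuclideanSpace ℝ (Fin d)) (m : ℕ) :
    HasFDerivAt (fun θ : EuclideanSpace ℝ (Fin d) => coord θ m) (coordL d m) θ := by
  simp only [coord_eq_coordL]
  exact (coordL d m).hasFDerivAt

/-- The values fed into the affine map from layer `k` to layer `k + 1`. -/
def layerInput (ℓ : ℕ → ℕ) {d : ℕ} (A : ℝ → ℝ) (θ : EuclideanSpace ℝ (Fin d))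
    (x : EuclideanSpace ℝ (Fin (ℓ 0))) : (k : ℕ) → Fin (ℓ k) → ℝ
  | 0 => fun i => x i
  | k + 1 => fun i => A (preact ℓ A θ x (k + 1) i)

/-- The input is not activated, so `preact` treats its first affine map separately. `layerInput`
absorbs this case, leaving a single inductive step. -/
theorem preact_succ (ℓ : ℕ → ℕ) {d : ℕ} (A : ℝ → ℝ) (θ : EuclideanSpace ℝ (Fin d))
    (x : EuclideanSpace ℝ (Fin (ℓ 0))) (k : ℕ) :
    preact ℓ A θ x (k + 1) = affineLayer ℓ θ k (layerInput ℓ A θ x k) := by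
  cases k <;> rfl

theorem layerInput_succ (ℓ : ℕ → ℕ) {d : ℕ} (A : ℝ → ℝ) (θ : EuclideanSpace ℝ (Fin d))
    (x : EuclideanSpace ℝ (Fin (ℓ 0))) (k : ℕ) (i : Fin (ℓ (k + 1))) :
    layerInput ℓ A θ x (k + 1) i = A (preact ℓ A θ x (k + 1) i) := rfl

/-- The derivative of an affine layer with respect to the parameters, if its input `v` has the
derivative `v'`. -/
noncomputable def affineDeriv (ℓ : ℕ → ℕ) {d : ℕ} (θ : EuclideanSpace ℝ (Fin d)) (k : ℕ)
    (v : Fin (ℓ k) → ℝ) (v' : Fin (ℓ k) → EuclideanSpace ℝ (Fin d) →L[ℝ] ℝ)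
    (i : Fin (ℓ (k + 1))) : EuclideanSpace ℝ (Fin d) →L[ℝ] ℝ :=
  coordL d (ℓ (k + 1) * ℓ k + i + paramDim ℓ k) +
    ∑ j, (weight ℓ θ k i j • v' j + v j • coordL d (i * ℓ k + j + paramDim ℓ k))

/-- The formal derivative of `layerInput` with respect to the parameters, with `a` in place of the
derivative of the activation `A`. -/
noncomputable def inputDeriv (ℓ : ℕ → ℕ) {d : ℕ} (A a : ℝ → ℝ) (θ : EuclideanSpace ℝ (Fin d))
    (x : EuclideanSpace ℝ (Fin (ℓ 0))) : (k : ℕ) → Fin (ℓ k) → EuclideanSpace ℝ (Fin d) →L[ℝ] ℝ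
  | 0 => fun _ => 0
  | k + 1 => fun i => a (preact ℓ A θ x (k + 1) i) •
      affineDeriv ℓ θ k (layerInput ℓ A θ x k) (inputDeriv ℓ A a θ x k) i

theorem hasFDerivAt_affineLayer (ℓ : ℕ → ℕ) {d : ℕ} {θ : EuclideanSpace ℝ (Fin d)} {k : ℕ}
    {v : EuclideanSpace ℝ (Fin d) → Fin (ℓ k) → ℝ}
    {v' : Fin (ℓ k) → EuclideanSpace ℝ (Fin d) →L[ℝ] ℝ}
    (hv : ∀ j, HasFDerivAt (fun θ => v θ j) (v' j) θ) (i : Fin (ℓ (k + 1))) :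
    HasFDerivAt (fun θ => affineLayer ℓ θ k (v θ) i) (affineDeriv ℓ θ k (v θ) v' i) θ := by
  unfold affineLayer affineDeriv
  exact (hasFDerivAt_coord θ _).add
    (HasFDerivAt.fun_sum fun j _ => (hasFDerivAt_coord θ _).mul (hv j))

/-- Chain rule. The activation need only be differentiable at the preactivations that actually
occur, so kinks elsewhere do no harm. -/
theorem hasFDerivAt_layerInput (ℓ : ℕ → ℕ) {d : ℕ} {A a : ℝ → ℝ} {θ : EuclideanSpace ℝ (Fin d)}
    {x : EuclideanSpace ℝ (Fin (ℓ 0))} {K : ℕ}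
    (h : ∀ k < K, ∀ i, HasDerivAt A (a (preact ℓ A θ x (k + 1) i)) (preact ℓ A θ x (k + 1) i))
    {k : ℕ} (hk : k ≤ K) (i : Fin (ℓ k)) :
    HasFDerivAt (fun θ => layerInput ℓ A θ x k i) (inputDeriv ℓ A a θ x k i) θ := by
  induction k with
  | zero => exact hasFDerivAt_const _ _
  | succ k ih =>
    have h1 := hasFDerivAt_affineLayer ℓ (fun j => ih (by omega) j) i
    have h2 := h k (by omega) i
    simp only [layerInput_succ, inputDeriv]
    simp only [preact_succ] at h2 ⊢
    exact h2.comp_hasFDerivAt θ h1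

theorem continuous_affineLayer (ℓ : ℕ → ℕ) {d : ℕ} {X : Type*} [TopologicalSpace X] {k : ℕ}
    {θ : X → EuclideanSpace ℝ (Fin d)} {v : X → Fin (ℓ k) → ℝ} (hθ : Continuous θ)
    (hv : ∀ j, Continuous fun q => v q j) (i : Fin (ℓ (k + 1))) :
    Continuous fun q => affineLayer ℓ (θ q) k (v q) i :=
  ((continuous_coord _).comp hθ).add
    (continuous_finsetSum _ fun j _ => ((continuous_coord _).comp hθ).mul (hv j))

theorem continuous_layerInput (ℓ : ℕ → ℕ) {d : ℕ} {A : ℝ → ℝ} (hA : Continuous A) (k : ℕ)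
    (i : Fin (ℓ k)) :
    Continuous fun q : EuclideanSpace ℝ (Fin d) × EuclideanSpace ℝ (Fin (ℓ 0)) =>
      layerInput ℓ A q.1 q.2 k i := by
  induction k with
  | zero => simp only [layerInput]; fun_prop
  | succ k ih =>
    simp only [layerInput_succ, preact_succ]
    exact hA.comp (continuous_affineLayer ℓ continuous_fst ih i)

theorem continuous_preact_succ (ℓ : ℕ → ℕ) {d : ℕ} {A : ℝ → ℝ} (hA : Continuous A) (k : ℕ)
    (i : Fin (ℓ (k + 1))) :
    Continuous fun q : EuclideanSpace ℝ (Fin d) × EuclideanSpace ℝ (Fin (ℓ 0)) =>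
      preact ℓ A q.1 q.2 (k + 1) i := by
  simp only [preact_succ]
  exact continuous_affineLayer ℓ continuous_fst (continuous_layerInput ℓ hA k) i

theorem tendsto_affineLayer (ℓ : ℕ → ℕ) {d : ℕ} {ι : Type*} {l : Filter ι} {k : ℕ}
    {θ : ι → EuclideanSpace ℝ (Fin d)} {v : ι → Fin (ℓ k) → ℝ}
    {θ₀ : EuclideanSpace ℝ (Fin d)} {v₀ : Fin (ℓ k) → ℝ} (hθ : Tendsto θ l (𝓝 θ₀))
    (hv : ∀ j, Tendsto (fun n => v n j) l (𝓝 (v₀ j))) (i : Fin (ℓ (k + 1))) :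
    Tendsto (fun n => affineLayer ℓ (θ n) k (v n) i) l (𝓝 (affineLayer ℓ θ₀ k v₀ i)) :=
  (((continuous_coord _).tendsto _).comp hθ).add
    (tendsto_finsetSum _ fun j _ => (((continuous_coord _).tendsto _).comp hθ).mul (hv j))

theorem tendsto_affineDeriv (ℓ : ℕ → ℕ) {d : ℕ} {ι : Type*} {l : Filter ι} {k : ℕ}
    {θ : ι → EuclideanSpace ℝ (Fin d)} {v : ι → Fin (ℓ k) → ℝ}
    {v' : ι → Fin (ℓ k) → EuclideanSpace ℝ (Fin d) →L[ℝ] ℝ}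
    {θ₀ : EuclideanSpace ℝ (Fin d)} {v₀ : Fin (ℓ k) → ℝ}
    {v₀' : Fin (ℓ k) → EuclideanSpace ℝ (Fin d) →L[ℝ] ℝ} (hθ : Tendsto θ l (𝓝 θ₀))
    (hv : ∀ j, Tendsto (fun n => v n j) l (𝓝 (v₀ j)))
    (hv' : ∀ j, Tendsto (fun n => v' n j) l (𝓝 (v₀' j))) (i : Fin (ℓ (k + 1))) :
    Tendsto (fun n => affineDeriv ℓ (θ n) k (v n) (v' n) i) l
      (𝓝 (affineDeriv ℓ θ₀ k v₀ v₀' i)) :=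
  tendsto_const_nhds.add (tendsto_finsetSum _ fun j _ =>
    ((((continuous_coord _).tendsto _).comp hθ).smul (hv' j)).add
      ((hv j).smul tendsto_const_nhds))

/-- Convergence of `a` is required only along the given preactivations. This covers both limits
needed: varying activation at fixed parameters, and varying parameters with a discontinuous `a`. -/
theorem tendsto_inputDeriv (ℓ : ℕ → ℕ) {d : ℕ} {ι : Type*} {l : Filter ι} {A a : ι → ℝ → ℝ}
    {A₀ a₀ : ℝ → ℝ} {θ : ι → EuclideanSpace ℝ (Fin d)} {θ₀ : EuclideanSpace ℝ (Fin d)}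
    {x : EuclideanSpace ℝ (Fin (ℓ 0))} {K : ℕ} (hθ : Tendsto θ l (𝓝 θ₀))
    (hA : ∀ k ≤ K, ∀ i, Tendsto (fun n => layerInput ℓ (A n) (θ n) x k i) l
      (𝓝 (layerInput ℓ A₀ θ₀ x k i)))
    (ha : ∀ k < K, ∀ i, Tendsto (fun n => a n (preact ℓ (A n) (θ n) x (k + 1) i)) l
      (𝓝 (a₀ (preact ℓ A₀ θ₀ x (k + 1) i))))
    {k : ℕ} (hk : k ≤ K) (i : Fin (ℓ k)) :
    Tendsto (fun n => inputDeriv ℓ (A n) (a n) (θ n) x k i) l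
      (𝓝 (inputDeriv ℓ A₀ a₀ θ₀ x k i)) := by
  induction k with
  | zero => exact tendsto_const_nhds
  | succ k ih =>
    exact (ha k (by omega) i).smul
      (tendsto_affineDeriv ℓ hθ (hA k (by omega)) (fun j => ih (by omega) j) i)

/-! ### Bounds uniform over activations with common local Lipschitz constants -/

/-- The function `A` is bounded by `C m` and `C m`-Lipschitz on `[-m, m]`, for every `m`. -/
def IsLocLip (C : ℕ → ℝ) (A : ℝ → ℝ) : Prop :=
  ∀ m : ℕ, ∀ x ∈ Set.Icc (-(m : ℝ)) m, |A x| ≤ C m ∧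
    ∀ y ∈ Set.Icc (-(m : ℝ)) m, |A x - A y| ≤ C m * |x - y|

theorem IsLocLip.nonneg {C : ℕ → ℝ} {A : ℝ → ℝ} (h : IsLocLip C A) (m : ℕ) : 0 ≤ C m :=
  (abs_nonneg _).trans (h m 0 (by simp)).1

theorem IsLocLip.continuous {C : ℕ → ℝ} {A : ℝ → ℝ} (h : IsLocLip C A) : Continuous A := by
  rw [continuous_iff_continuousAt]
  intro x
  obtain ⟨m, hm⟩ := exists_nat_gt |x|
  have hx : x ∈ Set.Ioo (-(m : ℝ)) m := abs_lt.1 hm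
  have hL : LipschitzOnWith (C m).toNNReal A (Set.Icc (-(m : ℝ)) m) := by
    refine LipschitzOnWith.of_dist_le_mul fun u hu v hv => ?_
    rw [Real.coe_toNNReal _ (h.nonneg m), Real.dist_eq, Real.dist_eq]
    exact (h m u hu).2 v hv
  exact hL.continuousOn.continuousAt (Icc_mem_nhds hx.1 hx.2)

theorem exists_affineLayer_bound (ℓ : ℕ → ℕ) (d k : ℕ) {R M : ℝ} (hR : 0 ≤ R) (hM : 0 ≤ M) :
    ∃ M' : ℝ, 0 ≤ M' ∧ ∀ θ θ' : EuclideanSpace ℝ (Fin d), ‖θ‖ ≤ R → ‖θ'‖ ≤ R →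
      ∀ v v' : Fin (ℓ k) → ℝ, (∀ j, |v j| ≤ M) → (∀ j, |v j - v' j| ≤ M * ‖θ - θ'‖) → ∀ i,
      |affineLayer ℓ θ k v i| ≤ M' ∧
        |affineLayer ℓ θ k v i - affineLayer ℓ θ' k v' i| ≤ M' * ‖θ - θ'‖ := by
  -- The first constant bounds the bias and `ℓ k` products; the second is the Lipschitz constant of
  -- the bias plus `ℓ k` product-rule terms.
  refine ⟨max (R + ℓ k * (R * M)) (1 + ℓ k * (M + R * M)), by positivity, ?_⟩
  intro θ θ' hθ hθ' v v' hv hvv i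
  constructor
  · refine le_trans ?_ (le_max_left _ _)
    refine (abs_add_le _ _).trans (add_le_add ((abs_coord_le _ _).trans hθ) ?_)
    refine (Finset.abs_sum_le_sum_abs _ _).trans ?_
    refine (Finset.sum_le_card_nsmul _ _ (R * M) fun j _ => ?_).trans (by simp)
    rw [abs_mul]
    exact mul_le_mul ((abs_coord_le _ _).trans hθ) (hv j) (abs_nonneg _) hR
  · refine le_trans ?_ (mul_le_mul_of_nonneg_right (le_max_right _ _) (norm_nonneg _))
    have e : affineLayer ℓ θ k v i - affineLayer ℓ θ' k v' i = (bias ℓ θ k i - bias ℓ θ' k i) +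
        ∑ j, (weight ℓ θ k i j * v j - weight ℓ θ' k i j * v' j) := by
      simp only [affineLayer, Finset.sum_sub_distrib]
      ring
    rw [e, add_mul, one_mul]
    refine (abs_add_le _ _).trans (add_le_add (abs_coord_sub_le _ _ _) ?_)
    refine (Finset.abs_sum_le_sum_abs _ _).trans ?_
    refine (Finset.sum_le_card_nsmul _ _ ((M + R * M) * ‖θ - θ'‖) fun j _ => ?_).trans
      (by simp [mul_assoc])
    have e2 : weight ℓ θ k i j * v j - weight ℓ θ' k i j * v' j =
        (weight ℓ θ k i j - weight ℓ θ' k i j) * v j + weight ℓ θ' k i j * (v j - v' j) := by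
      ring
    rw [e2]
    refine (abs_add_le _ _).trans ?_
    rw [abs_mul, abs_mul, add_mul]
    refine add_le_add ?_ ?_
    · rw [mul_comm]
      exact mul_le_mul (hv j) (abs_coord_sub_le _ _ _) (abs_nonneg _) hM
    · rw [mul_assoc]
      exact mul_le_mul ((abs_coord_le _ _).trans hθ') (hvv j) (abs_nonneg _) hR

theorem exists_layerInput_bound (ℓ : ℕ → ℕ) (d : ℕ) (C : ℕ → ℝ) {R : ℝ} (hR : 0 ≤ R) (k : ℕ) :
    ∃ M : ℝ, 0 ≤ M ∧ ∀ A, IsLocLip C A → ∀ x : EuclideanSpace ℝ (Fin (ℓ 0)), ‖x‖ ≤ R →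
      ∀ θ θ' : EuclideanSpace ℝ (Fin d), ‖θ‖ ≤ R → ‖θ'‖ ≤ R → ∀ i,
      |layerInput ℓ A θ x k i| ≤ M ∧
        |layerInput ℓ A θ x k i - layerInput ℓ A θ' x k i| ≤ M * ‖θ - θ'‖ := by
  induction k with
  | zero =>
    refine ⟨R, hR, fun A _ x hx θ θ' _ _ i => ⟨(abs_apply_le_norm _ _).trans hx, ?_⟩⟩
    simp only [layerInput, sub_self, abs_zero]
    positivity
  | succ k ih =>
    obtain ⟨M, hM, h⟩ := ih
    obtain ⟨M', hM', h'⟩ := exists_affineLayer_bound ℓ d k hR hM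
    obtain ⟨m, hm⟩ := exists_nat_ge M'
    -- The bound is chosen before any `A` is available to show `0 ≤ C m`, hence the maximum with
    -- `0`. The factor `1` serves the size bound, `M'` the Lipschitz bound.
    refine ⟨max (C m) 0 * max 1 M', by positivity, ?_⟩
    intro A hA x hx θ θ' hθ hθ' i
    have hC := hA.nonneg m
    rw [max_eq_left hC]
    have key : ∀ θ θ' : EuclideanSpace ℝ (Fin d), ‖θ‖ ≤ R → ‖θ'‖ ≤ R →
        |preact ℓ A θ x (k + 1) i| ≤ m ∧
        |preact ℓ A θ x (k + 1) i - preact ℓ A θ' x (k + 1) i| ≤ M' * ‖θ - θ'‖ := by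
      intro θ θ' hθ hθ'
      rw [preact_succ, preact_succ]
      have := h' θ θ' hθ hθ' _ _ (fun j => (h A hA x hx θ θ' hθ hθ' j).1)
        (fun j => (h A hA x hx θ θ' hθ hθ' j).2) i
      exact ⟨this.1.trans hm, this.2⟩
    have h1 := key θ θ' hθ hθ'
    have h2 := key θ' θ hθ' hθ
    have h3 := hA m _ (abs_le.1 h1.1)
    constructor
    · exact h3.1.trans (le_mul_of_one_le_right hC (le_max_left _ _))
    · refine (h3.2 _ (abs_le.1 h2.1)).trans ?_
      rw [mul_assoc]
      refine mul_le_mul_of_nonneg_left (h1.2.trans ?_) hC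
      exact mul_le_mul_of_nonneg_right (le_max_right _ _) (norm_nonneg _)

theorem exists_preact_bound (ℓ : ℕ → ℕ) (d : ℕ) (C : ℕ → ℝ) {R : ℝ} (hR : 0 ≤ R) (k : ℕ) :
    ∃ M : ℝ, 0 ≤ M ∧ ∀ A, IsLocLip C A → ∀ x : EuclideanSpace ℝ (Fin (ℓ 0)), ‖x‖ ≤ R →
      ∀ θ θ' : EuclideanSpace ℝ (Fin d), ‖θ‖ ≤ R → ‖θ'‖ ≤ R → ∀ i,
      |preact ℓ A θ x (k + 1) i| ≤ M ∧
        |preact ℓ A θ x (k + 1) i - preact ℓ A θ' x (k + 1) i| ≤ M * ‖θ - θ'‖ := by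
  obtain ⟨M, hM, h⟩ := exists_layerInput_bound ℓ d C hR k
  obtain ⟨M', hM', h'⟩ := exists_affineLayer_bound ℓ d k hR hM
  refine ⟨M', hM', fun A hA x hx θ θ' hθ hθ' i => ?_⟩
  rw [preact_succ, preact_succ]
  exact h' θ θ' hθ hθ' _ _ (fun j => (h A hA x hx θ θ' hθ hθ' j).1)
    (fun j => (h A hA x hx θ θ' hθ hθ' j).2) i

end ANN

namespace ANN

/-! ### Growth of `H` on cubes -/

/-- The closed cube `[-r, r]^n`. -/
def cube (n : ℕ) (r : ℝ) : Set (EuclideanSpace ℝ (Fin n)) := {v | ∀ i, |v i| ≤ r}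

theorem isCompact_cube (n : ℕ) (r : ℝ) : IsCompact (cube n r) := by
  have h : IsCompact (Set.univ.pi fun _ : Fin n => Set.Icc (-r) r) :=
    isCompact_univ_pi fun _ => isCompact_Icc
  have h2 := h.image (PiLp.continuous_toLp 2 (fun _ : Fin n => ℝ))
  convert h2
  ext v
  simp only [cube, Set.mem_ofPred_eq, Set.mem_image, Set.mem_univ_pi, Set.mem_Icc, abs_le]
  exact ⟨fun h => ⟨v.ofLp, h, rfl⟩, by rintro ⟨w, hw, rfl⟩; exact hw⟩

theorem convex_cube (n : ℕ) (r : ℝ) : Convex ℝ (cube n r) := by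
  intro u hu v hv s t hs ht hst i
  have h1 := abs_le.1 (hu i)
  have h2 := abs_le.1 (hv i)
  simp only [PiLp.add_apply, PiLp.smul_apply, smul_eq_mul]
  rw [abs_le]
  constructor <;> nlinarith

theorem norm_le_card_mul {n : ℕ} {v : EuclideanSpace ℝ (Fin n)} {b : ℝ} (hb : 0 ≤ b)
    (h : ∀ i, |v i| ≤ b) : ‖v‖ ≤ n * b := by
  refine abs_le_of_sq_le_sq' ?_ (by positivity) |>.2
  rw [EuclideanSpace.norm_sq_eq]
  calc ∑ i, ‖v i‖ ^ 2 ≤ ∑ _i : Fin n, b ^ 2 :=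
        Finset.sum_le_sum fun i _ => pow_le_pow_left₀ (norm_nonneg _) (h i) 2
    _ = n * b ^ 2 := by simp
    _ ≤ (n * b) ^ 2 := by
        rw [mul_pow]
        refine mul_le_mul_of_nonneg_right ?_ (sq_nonneg b)
        exact_mod_cast Nat.le_self_pow two_ne_zero n

theorem norm_gradient_eq {n : ℕ} (f : EuclideanSpace ℝ (Fin n) → ℝ)
    (x : EuclideanSpace ℝ (Fin n)) : ‖gradient f x‖ = ‖fderiv ℝ f x‖ := by
  unfold gradient
  exact LinearIsometryEquiv.norm_map _ _

section Growth

variable {c d e : ℕ}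
  {H : EuclideanSpace ℝ (Fin c) × EuclideanSpace ℝ (Fin d) × EuclideanSpace ℝ (Fin e) → ℝ}

theorem differentiable_left (hH : ContDiff ℝ 1 H) (θ : EuclideanSpace ℝ (Fin d))
    (y : EuclideanSpace ℝ (Fin e)) : Differentiable ℝ fun z => H (z, θ, y) :=
  (hH.differentiable one_ne_zero).comp (by fun_prop)

theorem differentiable_middle (hH : ContDiff ℝ 1 H) (z : EuclideanSpace ℝ (Fin c))
    (y : EuclideanSpace ℝ (Fin e)) : Differentiable ℝ fun θ => H (z, θ, y) :=
  (hH.differentiable one_ne_zero).comp (by fun_prop)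

/-- The reference point `X` will be a network output, which varies with the data, so the constant
must not depend on it. Compactness of the cube reduces this to a local statement in `X`. -/
theorem exists_uniform_growth (hH : ContDiff ℝ 1 H) {P : Set (EuclideanSpace ℝ (Fin e))} {r : ℝ}
    {Θ : EuclideanSpace ℝ (Fin d)} (hΘ : Θ ∈ cube d r)
    (h : ∀ X ∈ cube c r, ∃ C : ℝ, ∀ z ∈ cube c r, ∀ θ ∈ cube d r, ∀ y ∈ P,
      (‖gradient (fun z' => H (z', θ, y)) z‖ + ‖gradient (fun θ' => H (z, θ', y)) θ‖) /
        (1 + |H (X, Θ, y)|) ≤ C) :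
    ∃ K : ℝ, 0 ≤ K ∧ ∀ X ∈ cube c r, ∀ z ∈ cube c r, ∀ θ ∈ cube d r, ∀ y ∈ P,
      ‖fderiv ℝ (fun z' => H (z', θ, y)) z‖ ≤ K * (1 + |H (X, Θ, y)|) ∧
      ‖fderiv ℝ (fun θ' => H (z, θ', y)) θ‖ ≤ K * (1 + |H (X, Θ, y)|) := by
  have h' : ∀ X ∈ cube c r, ∃ C : ℝ, 0 ≤ C ∧ ∀ z ∈ cube c r, ∀ θ ∈ cube d r, ∀ y ∈ P,
      ‖fderiv ℝ (fun z' => H (z', θ, y)) z‖ ≤ C * (1 + |H (X, Θ, y)|) ∧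
      ‖fderiv ℝ (fun θ' => H (z, θ', y)) θ‖ ≤ C * (1 + |H (X, Θ, y)|) := by
    intro X hX
    obtain ⟨C, hC⟩ := h X hX
    refine ⟨max C 0, le_max_right _ _, fun z hz θ hθ y hy => ?_⟩
    have hpos : 0 < 1 + |H (X, Θ, y)| := by positivity
    have h1 := hC z hz θ hθ y hy
    rw [div_le_iff₀ hpos, norm_gradient_eq, norm_gradient_eq] at h1
    have h2 := mul_le_mul_of_nonneg_right (le_max_left C 0) hpos.le
    have h3 := norm_nonneg (fderiv ℝ (fun z' => H (z', θ, y)) z)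
    have h4 := norm_nonneg (fderiv ℝ (fun θ' => H (z, θ', y)) θ)
    constructor <;> linarith
  refine (isCompact_cube c r).induction_on (p := fun s => ∃ K : ℝ, 0 ≤ K ∧ ∀ X ∈ s,
    ∀ z ∈ cube c r, ∀ θ ∈ cube d r, ∀ y ∈ P,
      ‖fderiv ℝ (fun z' => H (z', θ, y)) z‖ ≤ K * (1 + |H (X, Θ, y)|) ∧
      ‖fderiv ℝ (fun θ' => H (z, θ', y)) θ‖ ≤ K * (1 + |H (X, Θ, y)|)) ?_ ?_ ?_ ?_
  · exact ⟨0, le_rfl, by simp⟩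
  · rintro s t hst ⟨K, hK, h⟩
    exact ⟨K, hK, fun X hX => h X (hst hX)⟩
  · rintro s t ⟨K₁, hK₁, h₁⟩ ⟨K₂, hK₂, h₂⟩
    refine ⟨max K₁ K₂, by positivity, ?_⟩
    rintro X hX z hz θ hθ y hy
    have hpos : 0 ≤ 1 + |H (X, Θ, y)| := by positivity
    have b1 := mul_le_mul_of_nonneg_right (le_max_left K₁ K₂) hpos
    have b2 := mul_le_mul_of_nonneg_right (le_max_right K₁ K₂) hpos
    rcases hX with hX | hX
    · have := h₁ X hX z hz θ hθ y hy
      exact ⟨this.1.trans b1, this.2.trans b1⟩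
    · have := h₂ X hX z hz θ hθ y hy
      exact ⟨this.1.trans b2, this.2.trans b2⟩
  · intro X hX
    obtain ⟨C, hC0, hC⟩ := h' X hX
    -- On this neighbourhood the mean value inequality bounds the loss in `|H|` from `X` to `Y` by
    -- half of `1 + |H (X, Θ, y)|`, so changing the reference point costs at most a factor 2.
    refine ⟨cube c r ∩ {Y | C * ‖Y - X‖ < 1 / 2}, ?_, 2 * C, by positivity, ?_⟩
    · refine inter_mem self_mem_nhdsWithin (mem_nhdsWithin_of_mem_nhds ?_)
      have : Continuous fun Y : EuclideanSpace ℝ (Fin c) => C * ‖Y - X‖ := by fun_prop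
      exact (isOpen_lt this continuous_const).mem_nhds (by simp)
    · rintro Y ⟨hY, hYX⟩ z hz θ hθ y hy
      have hpos : 0 ≤ 1 + |H (X, Θ, y)| := by positivity
      have h1 : ‖H (Y, Θ, y) - H (X, Θ, y)‖ ≤ C * (1 + |H (X, Θ, y)|) * ‖Y - X‖ :=
        (convex_cube c r).norm_image_sub_le_of_norm_fderiv_le (𝕜 := ℝ)
          (f := fun z => H (z, Θ, y))
          (fun z _ => differentiable_left hH Θ y z) (fun z hz => (hC z hz Θ hΘ y hy).1) hX hY
      have h2 : |H (X, Θ, y)| - |H (Y, Θ, y)| ≤ ‖H (Y, Θ, y) - H (X, Θ, y)‖ := by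
        rw [Real.norm_eq_abs, abs_sub_comm]
        exact abs_sub_abs_le_abs_sub _ _
      have hYX' : C * ‖Y - X‖ ≤ 1 / 2 := le_of_lt hYX
      have h3 := mul_le_mul_of_nonneg_right hYX' hpos
      have h4 : 1 + |H (X, Θ, y)| ≤ 2 * (1 + |H (Y, Θ, y)|) := by
        have := abs_nonneg (H (Y, Θ, y))
        linarith [h1, h2, h3]
      have h5 := mul_le_mul_of_nonneg_left h4 hC0
      have h6 := hC z hz θ hθ y hy
      constructor
      · linarith [h6.1]
      · linarith [h6.2]

end Growth

/-! ### Differentiating the integrand and the risk -/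

variable {ℓ : ℕ → ℕ} {K : ℕ}
  {H : EuclideanSpace ℝ (Fin (ℓ (K + 1))) × EuclideanSpace ℝ (Fin (paramDim ℓ (K + 1))) ×
      EuclideanSpace ℝ (Fin (ℓ (K + 1))) → ℝ}
  {μ : Measure (EuclideanSpace ℝ (Fin (ℓ 0)) × EuclideanSpace ℝ (Fin (ℓ (K + 1))))}

/-- The integrand of the objective function. -/
def loss (ℓ : ℕ → ℕ) (K : ℕ)
    (H : EuclideanSpace ℝ (Fin (ℓ (K + 1))) × EuclideanSpace ℝ (Fin (paramDim ℓ (K + 1))) ×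
      EuclideanSpace ℝ (Fin (ℓ (K + 1))) → ℝ)
    (A : ℝ → ℝ) (θ : EuclideanSpace ℝ (Fin (paramDim ℓ (K + 1))))
    (p : EuclideanSpace ℝ (Fin (ℓ 0)) × EuclideanSpace ℝ (Fin (ℓ (K + 1)))) : ℝ :=
  H (realization ℓ (K + 1) A θ p.1, θ, p.2)

/-- The formal derivative of the realization function with respect to the parameters. -/
noncomputable def realizationDeriv (ℓ : ℕ → ℕ) (K : ℕ) (A a : ℝ → ℝ)
    (θ : EuclideanSpace ℝ (Fin (paramDim ℓ (K + 1)))) (x : EuclideanSpace ℝ (Fin (ℓ 0))) :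
    EuclideanSpace ℝ (Fin (paramDim ℓ (K + 1))) →L[ℝ] EuclideanSpace ℝ (Fin (ℓ (K + 1))) :=
  ∑ i, (affineDeriv ℓ θ K (layerInput ℓ A θ x K) (inputDeriv ℓ A a θ x K) i).smulRight
    (EuclideanSpace.single i 1)

/-- The formal derivative of the integrand of the objective function. -/
noncomputable def lossDeriv (ℓ : ℕ → ℕ) (K : ℕ)
    (H : EuclideanSpace ℝ (Fin (ℓ (K + 1))) × EuclideanSpace ℝ (Fin (paramDim ℓ (K + 1))) ×
      EuclideanSpace ℝ (Fin (ℓ (K + 1))) → ℝ)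
    (A a : ℝ → ℝ) (θ : EuclideanSpace ℝ (Fin (paramDim ℓ (K + 1))))
    (p : EuclideanSpace ℝ (Fin (ℓ 0)) × EuclideanSpace ℝ (Fin (ℓ (K + 1)))) :
    EuclideanSpace ℝ (Fin (paramDim ℓ (K + 1))) →L[ℝ] ℝ :=
  fderiv ℝ H (realization ℓ (K + 1) A θ p.1, θ, p.2) ∘L
    (realizationDeriv ℓ K A a θ p.1).prod ((ContinuousLinearMap.id ℝ _).prod 0)

theorem realization_apply (ℓ : ℕ → ℕ) (L : ℕ) (A : ℝ → ℝ)
    (θ : EuclideanSpace ℝ (Fin (paramDim ℓ L))) (x : EuclideanSpace ℝ (Fin (ℓ 0)))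
    (i : Fin (ℓ L)) : realization ℓ L A θ x i = preact ℓ A θ x L i := rfl

theorem hasFDerivAt_loss (hH : ContDiff ℝ 1 H) {A a : ℝ → ℝ}
    {θ : EuclideanSpace ℝ (Fin (paramDim ℓ (K + 1)))}
    {p : EuclideanSpace ℝ (Fin (ℓ 0)) × EuclideanSpace ℝ (Fin (ℓ (K + 1)))}
    (h : ∀ k < K, ∀ i,
      HasDerivAt A (a (preact ℓ A θ p.1 (k + 1) i)) (preact ℓ A θ p.1 (k + 1) i)) :
    HasFDerivAt (fun θ => loss ℓ K H A θ p) (lossDeriv ℓ K H A a θ p) θ := by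
  have h1 : HasFDerivAt (fun θ => realization ℓ (K + 1) A θ p.1)
      (realizationDeriv ℓ K A a θ p.1) θ := by
    rw [← hasFDerivWithinAt_univ, hasFDerivWithinAt_euclidean]
    intro i
    rw [hasFDerivWithinAt_univ]
    simp only [realization_apply, preact_succ]
    refine (hasFDerivAt_affineLayer ℓ
      (fun j => hasFDerivAt_layerInput ℓ h le_rfl j) i).congr_fderiv ?_
    ext v
    simp [realizationDeriv]
  have h2 := h1.prodMk ((hasFDerivAt_id θ).prodMk (hasFDerivAt_const p.2 θ))
  exact (hH.differentiable one_ne_zero _).hasFDerivAt.comp θ h2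

theorem tendsto_lossDeriv (hH : ContDiff ℝ 1 H) {ι : Type*} {l : Filter ι} {A a : ι → ℝ → ℝ}
    {A₀ a₀ : ℝ → ℝ} {θ : ι → EuclideanSpace ℝ (Fin (paramDim ℓ (K + 1)))}
    {θ₀ : EuclideanSpace ℝ (Fin (paramDim ℓ (K + 1)))}
    {p : EuclideanSpace ℝ (Fin (ℓ 0)) × EuclideanSpace ℝ (Fin (ℓ (K + 1)))}
    (hθ : Tendsto θ l (𝓝 θ₀))
    (hA : ∀ k ≤ K, ∀ i, Tendsto (fun n => layerInput ℓ (A n) (θ n) p.1 k i) l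
      (𝓝 (layerInput ℓ A₀ θ₀ p.1 k i)))
    (ha : ∀ k < K, ∀ i, Tendsto (fun n => a n (preact ℓ (A n) (θ n) p.1 (k + 1) i)) l
      (𝓝 (a₀ (preact ℓ A₀ θ₀ p.1 (k + 1) i)))) :
    Tendsto (fun n => lossDeriv ℓ K H (A n) (a n) (θ n) p) l
      (𝓝 (lossDeriv ℓ K H A₀ a₀ θ₀ p)) := by
  have h1 : Tendsto (fun n => realization ℓ (K + 1) (A n) (θ n) p.1) l
      (𝓝 (realization ℓ (K + 1) A₀ θ₀ p.1)) := by
    refine ((PiLp.continuous_toLp 2 (fun _ : Fin (ℓ (K + 1)) => ℝ)).tendsto _).comp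
      (tendsto_pi_nhds.2 fun i => ?_)
    simp only [preact_succ]
    exact tendsto_affineLayer ℓ hθ (hA K le_rfl) i
  have h2 : Tendsto (fun n => realizationDeriv ℓ K (A n) (a n) (θ n) p.1) l
      (𝓝 (realizationDeriv ℓ K A₀ a₀ θ₀ p.1)) := by
    refine tendsto_finsetSum _ fun i _ => ?_
    have h3 := tendsto_affineDeriv ℓ hθ (hA K le_rfl)
      (fun j => tendsto_inputDeriv ℓ hθ hA ha le_rfl j) i
    exact (((ContinuousLinearMap.smulRightL ℝ (EuclideanSpace ℝ (Fin (paramDim ℓ (K + 1))))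
      (EuclideanSpace ℝ (Fin (ℓ (K + 1))))).flip (EuclideanSpace.single i 1)).continuous.tendsto
        _).comp h3
  have h4 := (hH.continuous_fderiv one_ne_zero).tendsto (realization ℓ (K + 1) A₀ θ₀ p.1, θ₀, p.2)
  have h5 := h4.comp (h1.prodMk_nhds (hθ.prodMk_nhds tendsto_const_nhds))
  have h6 : Tendsto (fun n => (realizationDeriv ℓ K (A n) (a n) (θ n) p.1).prod
      ((ContinuousLinearMap.id ℝ (EuclideanSpace ℝ (Fin (paramDim ℓ (K + 1))))).prod
        (0 : _ →L[ℝ] EuclideanSpace ℝ (Fin (ℓ (K + 1)))))) l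
      (𝓝 ((realizationDeriv ℓ K A₀ a₀ θ₀ p.1).prod ((ContinuousLinearMap.id ℝ _).prod 0))) :=
    ((ContinuousLinearMap.prodL ℝ).continuous.tendsto (_, _)).comp
      (h2.prodMk_nhds tendsto_const_nhds)
  have h7 : Continuous fun q : (_ →L[ℝ] ℝ) × (EuclideanSpace ℝ (Fin (paramDim ℓ (K + 1))) →L[ℝ]
      EuclideanSpace ℝ (Fin (ℓ (K + 1))) × EuclideanSpace ℝ (Fin (paramDim ℓ (K + 1))) ×
        EuclideanSpace ℝ (Fin (ℓ (K + 1)))) => q.1 ∘L q.2 :=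
    continuous_fst.clm_comp continuous_snd
  exact (h7.tendsto _).comp (h5.prodMk_nhds h6)

theorem continuous_loss (hH : ContDiff ℝ 1 H) {A : ℝ → ℝ} (hA : Continuous A) :
    Continuous (Function.uncurry fun p θ => loss ℓ K H A θ p) := by
  refine hH.continuous.comp ?_
  refine Continuous.prodMk ?_ (by fun_prop)
  refine (PiLp.continuous_toLp 2 (fun _ : Fin (ℓ (K + 1)) => ℝ)).comp
    (continuous_pi fun i => ?_)
  exact (continuous_preact_succ ℓ hA K i).comp
    (continuous_snd.prodMk (continuous_fst.comp continuous_fst))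

/-- On the bounded input projection of the support, all these networks keep their outputs in one
cube, where the growth bound applies. Taking the output of `A₀` at `θ₀` as reference point makes the
Lipschitz constant integrable in `p` and independent of `A`. -/
theorem exists_loss_lipschitz (hH : ContDiff ℝ 1 H)
    (hsupp : Bornology.IsBounded {x : EuclideanSpace ℝ (Fin (ℓ 0)) | ∃ y, (x, y) ∈ μ.support})
    {C : ℕ → ℝ} {A₀ : ℝ → ℝ} (hA₀ : IsLocLip C A₀)
    (hgrowth : ∀ r : ℝ, 0 < r →
      ∀ X : EuclideanSpace ℝ (Fin (ℓ (K + 1))), (∀ i, |X i| ≤ r) →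
      ∀ Θ : EuclideanSpace ℝ (Fin (paramDim ℓ (K + 1))), (∀ i, |Θ i| ≤ r) →
      ∃ C : ℝ, ∀ z : EuclideanSpace ℝ (Fin (ℓ (K + 1))), (∀ i, |z i| ≤ r) →
        ∀ θ : EuclideanSpace ℝ (Fin (paramDim ℓ (K + 1))), (∀ i, |θ i| ≤ r) →
        ∀ x y, (x, y) ∈ μ.support →
          (‖gradient (fun z' => H (z', θ, y)) z‖ + ‖gradient (fun θ' => H (z, θ', y)) θ‖) /
            (1 + |H (X, Θ, y)|) ≤ C)
    (θ₀ : EuclideanSpace ℝ (Fin (paramDim ℓ (K + 1)))) :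
    ∃ B : ℝ, 0 ≤ B ∧ ∀ A, IsLocLip C A → ∀ p ∈ μ.support,
      ∀ θ ∈ Metric.ball θ₀ 1, ∀ θ' ∈ Metric.ball θ₀ 1,
      |loss ℓ K H A θ p - loss ℓ K H A θ' p| ≤
        B * (1 + |loss ℓ K H A₀ θ₀ p|) * ‖θ - θ'‖ := by
  obtain ⟨Rx, hRx⟩ := hsupp.exists_norm_le
  set R := max (‖θ₀‖ + 1) Rx with hR
  have hR0 : 0 ≤ R := le_trans (by positivity) (le_max_left _ _)
  obtain ⟨M, hM, hb⟩ := exists_preact_bound ℓ (paramDim ℓ (K + 1)) C hR0 K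
  set r := max M (‖θ₀‖ + 1) with hr
  have hr0 : 0 < r := lt_of_lt_of_le (by positivity) (le_max_right _ _)
  have hball : ∀ θ ∈ Metric.ball θ₀ 1, ‖θ‖ ≤ ‖θ₀‖ + 1 := by
    intro θ hθ
    have h1 : ‖θ - θ₀‖ < 1 := mem_ball_iff_norm.1 hθ
    have h2 := norm_le_norm_add_norm_sub' θ θ₀
    linarith
  have hcube : ∀ θ ∈ Metric.ball θ₀ 1, θ ∈ cube (paramDim ℓ (K + 1)) r := fun θ hθ i =>
    (abs_apply_le_norm θ i).trans ((hball θ hθ).trans (le_max_right _ _))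
  have hθ₀ : θ₀ ∈ Metric.ball θ₀ 1 := Metric.mem_ball_self one_pos
  obtain ⟨B, hB, hBb⟩ := exists_uniform_growth (P := {y | ∃ x, (x, y) ∈ μ.support}) hH
    (hcube θ₀ hθ₀) (fun X hX => by
      obtain ⟨C, hC⟩ := hgrowth r hr0 X hX θ₀ (hcube θ₀ hθ₀)
      exact ⟨C, fun z hz θ hθ y ⟨x, hy⟩ => hC z hz θ hθ x y hy⟩)
  -- `ℓ (K + 1) * M` is a Lipschitz constant of the network output in the parameters; the `1`
  -- accounts for the direct dependence of `H` on them.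
  refine ⟨B * (ℓ (K + 1) * M + 1), by positivity, ?_⟩
  rintro A hA ⟨x, y⟩ hp θ hθ θ' hθ'
  have hx : ‖x‖ ≤ R := (hRx x ⟨y, hp⟩).trans (le_max_right _ _)
  have hy : y ∈ {y | ∃ x, (x, y) ∈ μ.support} := ⟨x, hp⟩
  have hnet : ∀ A, IsLocLip C A → ∀ θ ∈ Metric.ball θ₀ 1,
      realization ℓ (K + 1) A θ x ∈ cube (ℓ (K + 1)) r := by
    intro A hA θ hθ i
    have h1 := (hball θ hθ).trans (le_max_left _ Rx)
    exact (hb A hA x hx θ θ h1 h1 i).1.trans (le_max_left _ _)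
  have hlip : ‖realization ℓ (K + 1) A θ x - realization ℓ (K + 1) A θ' x‖ ≤
      ℓ (K + 1) * (M * ‖θ - θ'‖) := by
    refine norm_le_card_mul (by positivity) fun i => ?_
    exact (hb A hA x hx θ θ' ((hball θ hθ).trans (le_max_left _ Rx))
      ((hball θ' hθ').trans (le_max_left _ Rx)) i).2
  have hbnd := hBb _ (hnet A₀ hA₀ θ₀ hθ₀)
  set D := B * (1 + |H (realization ℓ (K + 1) A₀ θ₀ x, θ₀, y)|) with hD
  have hD0 : 0 ≤ D := by positivity
  have h1 : ‖H (realization ℓ (K + 1) A θ x, θ, y) - H (realization ℓ (K + 1) A θ' x, θ, y)‖ ≤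
      D * ‖realization ℓ (K + 1) A θ x - realization ℓ (K + 1) A θ' x‖ :=
    (convex_cube _ r).norm_image_sub_le_of_norm_fderiv_le (𝕜 := ℝ) (f := fun z => H (z, θ, y))
      (fun z _ => differentiable_left hH θ y z)
      (fun z hz => (hbnd z hz θ (hcube θ hθ) y hy).1) (hnet A hA θ' hθ') (hnet A hA θ hθ)
  have h2 : ‖H (realization ℓ (K + 1) A θ' x, θ, y) - H (realization ℓ (K + 1) A θ' x, θ', y)‖ ≤
      D * ‖θ - θ'‖ :=
    (convex_cube _ r).norm_image_sub_le_of_norm_fderiv_le (𝕜 := ℝ)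
      (f := fun θ => H (realization ℓ (K + 1) A θ' x, θ, y))
      (fun θ _ => differentiable_middle hH _ y θ)
      (fun θ hθ => (hbnd _ (hnet A hA θ' hθ') θ hθ y hy).2) (hcube θ' hθ') (hcube θ hθ)
  have h3 := mul_le_mul_of_nonneg_left hlip hD0
  have h4 := norm_sub_le_norm_sub_add_norm_sub (H (realization ℓ (K + 1) A θ x, θ, y))
    (H (realization ℓ (K + 1) A θ' x, θ, y)) (H (realization ℓ (K + 1) A θ' x, θ', y))
  rw [← Real.norm_eq_abs]
  calc _ ≤ D * (ℓ (K + 1) * (M * ‖θ - θ'‖)) + D * ‖θ - θ'‖ := by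
        exact h4.trans (add_le_add (h1.trans h3) h2)
    _ = _ := by
        simp only [loss, hD]
        ring

/-- Differentiation under the integral sign at a parameter vector at which almost every
preactivation avoids the kinks of the activation. -/
theorem hasFDerivAt_risk (hH : ContDiff ℝ 1 H) {A a : ℝ → ℝ} (hA : Continuous A)
    {b : EuclideanSpace ℝ (Fin (ℓ 0)) × EuclideanSpace ℝ (Fin (ℓ (K + 1))) → ℝ}
    (hb0 : ∀ p, 0 ≤ b p) (hb : Integrable b μ)
    {θ : EuclideanSpace ℝ (Fin (paramDim ℓ (K + 1)))}
    (hint : Integrable (loss ℓ K H A θ) μ)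
    {U : Set (EuclideanSpace ℝ (Fin (paramDim ℓ (K + 1))))} (hU : U ∈ 𝓝 θ)
    (hlip : ∀ᵐ p ∂μ, ∀ θ₁ ∈ U, ∀ θ₂ ∈ U,
      |loss ℓ K H A θ₁ p - loss ℓ K H A θ₂ p| ≤ b p * ‖θ₁ - θ₂‖)
    (hdiff : ∀ᵐ p ∂μ, ∀ k < K, ∀ i,
      HasDerivAt A (a (preact ℓ A θ p.1 (k + 1) i)) (preact ℓ A θ p.1 (k + 1) i)) :
    HasFDerivAt (risk ℓ (K + 1) H μ A) (∫ p, lossDeriv ℓ K H A a θ p ∂μ) θ ∧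
      AEStronglyMeasurable (lossDeriv ℓ K H A a θ) μ ∧
      ∀ᵐ p ∂μ, ‖lossDeriv ℓ K H A a θ p‖ ≤ b p := by
  have hc := continuous_loss (ℓ := ℓ) (K := K) hH hA
  have hd : ∀ᵐ p ∂μ, HasFDerivAt (fun θ => loss ℓ K H A θ p) (lossDeriv ℓ K H A a θ p) θ := by
    filter_upwards [hdiff] with p hp using hasFDerivAt_loss hH hp
  -- No measurability of `a` is assumed; it is inherited from the true derivative of the jointly
  -- continuous integrand, with which the formal one agrees almost everywhere.
  have hmeas : AEStronglyMeasurable (lossDeriv ℓ K H A a θ) μ := by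
    have h1 := (measurable_fderiv_with_param ℝ hc).comp (measurable_prodMk_right (y := θ))
    refine (h1.aestronglyMeasurable (μ := μ)).congr ?_
    filter_upwards [hd] with p hp using hp.fderiv
  have hlip' : ∀ᵐ p ∂μ, LipschitzOnWith (Real.nnabs (b p)) (fun θ => loss ℓ K H A θ p) U := by
    filter_upwards [hlip] with p hp
    refine LipschitzOnWith.of_dist_le_mul fun u hu v hv => ?_
    rw [Real.coe_nnabs, abs_of_nonneg (hb0 p), Real.dist_eq, dist_eq_norm]
    exact hp u hu v hv
  refine ⟨?_, hmeas, ?_⟩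
  · refine (hasFDerivAt_integral_of_dominated_loc_of_lip (F := fun θ p => loss ℓ K H A θ p) hU ?_
      hint hmeas hlip' hb hd).2
    refine Eventually.of_forall fun θ' => ?_
    exact (hc.comp (Continuous.prodMk_left θ')).aestronglyMeasurable
  · filter_upwards [hd, hlip'] with p hp hl
    have := hp.le_of_lipschitzOn hU hl
    rwa [Real.coe_nnabs, abs_of_nonneg (hb0 p)] at this

end ANN

namespace ANN

/-! ### Generic perturbation of the parameters -/

/-- The direction which raises all coordinates from the biases of layer `k + 1` onwards. -/
noncomputable def biasShift (ℓ : ℕ → ℕ) (d k : ℕ) : EuclideanSpace ℝ (Fin d) :=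
  WithLp.toLp 2 fun m => if ℓ (k + 1) * ℓ k + paramDim ℓ k ≤ (m : ℕ) then 1 else 0

theorem coord_add_smul_biasShift (ℓ : ℕ → ℕ) {d k : ℕ} (θ : EuclideanSpace ℝ (Fin d)) (t : ℝ)
    {m : ℕ} (hm : m < d) :
    coord (θ + t • biasShift ℓ d k) m =
      coord θ m + if ℓ (k + 1) * ℓ k + paramDim ℓ k ≤ m then t else 0 := by
  simp [coord, hm, biasShift]

theorem coord_add_smul_biasShift_of_lt (ℓ : ℕ → ℕ) {d k : ℕ} (θ : EuclideanSpace ℝ (Fin d))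
    (t : ℝ) {m : ℕ} (hm : m < ℓ (k + 1) * ℓ k + paramDim ℓ k) :
    coord (θ + t • biasShift ℓ d k) m = coord θ m := by
  by_cases h : m < d
  · rw [coord_add_smul_biasShift ℓ θ t h, if_neg (not_le.2 hm), add_zero]
  · simp [coord, h]

/-- All parameters of earlier layers are numbered before the first shifted coordinate. -/
theorem affineLayer_add_smul_biasShift_of_lt (ℓ : ℕ → ℕ) {d j k : ℕ}
    (θ : EuclideanSpace ℝ (Fin d)) (t : ℝ) (hj : j < k) :
    affineLayer ℓ (θ + t • biasShift ℓ d k) j = affineLayer ℓ θ j := by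
  funext v i
  have h1 := bias_index_lt ℓ hj i
  unfold affineLayer bias weight
  rw [coord_add_smul_biasShift_of_lt ℓ θ t (by omega)]
  congr 1
  refine Finset.sum_congr rfl fun c _ => ?_
  have h2 := weight_index_lt ℓ hj i c
  rw [coord_add_smul_biasShift_of_lt ℓ θ t (by omega)]

/-- Within a layer the weights precede the biases, so only the biases move. -/
theorem affineLayer_add_smul_biasShift (ℓ : ℕ → ℕ) {L k : ℕ} (hk : k < L)
    (θ : EuclideanSpace ℝ (Fin (paramDim ℓ L))) (t : ℝ) (v : Fin (ℓ k) → ℝ)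
    (i : Fin (ℓ (k + 1))) :
    affineLayer ℓ (θ + t • biasShift ℓ (paramDim ℓ L) k) k v i = affineLayer ℓ θ k v i + t := by
  have h1 := bias_index_lt ℓ hk i
  unfold affineLayer bias weight
  rw [coord_add_smul_biasShift ℓ θ t h1, if_pos (by omega), add_right_comm]
  congr 2
  refine Finset.sum_congr rfl fun c _ => ?_
  have h2 := c.isLt
  have h3 : ((i : ℕ) + 1) * ℓ k ≤ ℓ (k + 1) * ℓ k := Nat.mul_le_mul_right _ i.isLt
  rw [add_mul, one_mul] at h3
  rw [coord_add_smul_biasShift_of_lt ℓ θ t (by omega)]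

theorem layerInput_add_smul_biasShift (ℓ : ℕ → ℕ) {d j k : ℕ} (A : ℝ → ℝ)
    (θ : EuclideanSpace ℝ (Fin d)) (x : EuclideanSpace ℝ (Fin (ℓ 0))) (t : ℝ) (hj : j ≤ k) :
    layerInput ℓ A (θ + t • biasShift ℓ d k) x j = layerInput ℓ A θ x j := by
  induction j with
  | zero => rfl
  | succ j ih =>
    funext i
    rw [layerInput_succ, layerInput_succ, preact_succ, preact_succ, ih (by omega),
      affineLayer_add_smul_biasShift_of_lt ℓ θ t (by omega)]

theorem preact_add_smul_biasShift_of_lt (ℓ : ℕ → ℕ) {d j k : ℕ} (A : ℝ → ℝ)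
    (θ : EuclideanSpace ℝ (Fin d)) (x : EuclideanSpace ℝ (Fin (ℓ 0))) (t : ℝ) (hj : j < k) :
    preact ℓ A (θ + t • biasShift ℓ d k) x (j + 1) = preact ℓ A θ x (j + 1) := by
  rw [preact_succ, preact_succ, layerInput_add_smul_biasShift ℓ A θ x t hj.le,
    affineLayer_add_smul_biasShift_of_lt ℓ θ t hj]

theorem preact_add_smul_biasShift (ℓ : ℕ → ℕ) {L k : ℕ} (hk : k < L) (A : ℝ → ℝ)
    (θ : EuclideanSpace ℝ (Fin (paramDim ℓ L))) (x : EuclideanSpace ℝ (Fin (ℓ 0))) (t : ℝ)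
    (i : Fin (ℓ (k + 1))) :
    preact ℓ A (θ + t • biasShift ℓ (paramDim ℓ L) k) x (k + 1) i =
      preact ℓ A θ x (k + 1) i + t := by
  rw [preact_succ, preact_succ, layerInput_add_smul_biasShift ℓ A θ x t le_rfl,
    affineLayer_add_smul_biasShift ℓ hk]

/-- Shifting finitely many random variables by a generic amount makes them avoid a finite set. -/
theorem exists_shift_avoiding {Ω ι : Type*} [MeasurableSpace Ω] {μ : Measure Ω} [SFinite μ]
    [Finite ι] {f : ι → Ω → ℝ} (hf : ∀ i, Measurable (f i)) (S : Finset ℝ) {z : ℝ} (hz : z ≠ 0)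
    {u v : ℝ} (huv : u < v) :
    ∃ t ∈ Set.Ioo u v, ∀ i, ∀ᵐ p ∂μ, f i p + t * z ∉ S := by
  -- For fixed `i` and `s` the events for distinct `t` are disjoint level sets of `(s - f i) / z`,
  -- so only countably many can have positive mass.
  have hcount : (⋃ i, ⋃ s ∈ S, {t : ℝ | 0 < μ {p | f i p + t * z = s}}).Countable := by
    refine Set.countable_iUnion fun i => (S.countable_toSet).biUnion fun s _ => ?_
    have h1 := Measure.countable_meas_level_set_pos (μ := μ)
      (((measurable_const (a := s)).sub (hf i)).div_const z)
    refine h1.mono fun t ht => lt_of_lt_of_le ht (measure_mono fun p hp => ?_)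
    have hp' : f i p + t * z = s := hp
    show (s - f i p) / z = t
    rw [← hp']
    field_simp
    ring
  obtain ⟨t, ht, htn⟩ : ∃ t ∈ Set.Ioo u v,
      t ∉ ⋃ i, ⋃ s ∈ S, {t : ℝ | 0 < μ {p | f i p + t * z = s}} := by
    by_contra! h
    exact (Cardinal.Real.Ioo_countable_iff.not.2 (not_le.2 huv)) (hcount.mono h)
  refine ⟨t, ht, fun i => ?_⟩
  have h2 : ∀ s ∈ S, ∀ᵐ p ∂μ, f i p + t * z ≠ s := by
    intro s hs
    rw [ae_iff]
    simp only [ne_eq, not_not]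
    by_contra hne
    exact htn (Set.mem_iUnion.2 ⟨i, Set.mem_iUnion₂.2 ⟨s, hs, pos_iff_ne_zero.2 hne⟩⟩)
  have h3 := (ae_ball_iff S.countable_toSet).2 h2
  filter_upwards [h3] with p hp hmem using hp _ hmem rfl

/-- Induction over layers: shifting the biases of the new layer leaves earlier layers untouched. The
coordinates of later layers move too, but these are not yet constrained. -/
theorem exists_generic_perturbation (ℓ : ℕ → ℕ) {L : ℕ}
    {Y : Type*} [MeasurableSpace Y] {μ : Measure (EuclideanSpace ℝ (Fin (ℓ 0)) × Y)} [SFinite μ]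
    {C : ℕ → ℝ} {A : ℝ → ℝ} (hA : IsLocLip C A) (S : Finset ℝ) {z : ℝ} (hz : z * z = 1)
    (R : ℝ) (θ : EuclideanSpace ℝ (Fin (paramDim ℓ L))) {k : ℕ} (hk : k ≤ L) {δ : ℝ} (hδ : 0 < δ) :
    ∃ θ' : EuclideanSpace ℝ (Fin (paramDim ℓ L)), ‖θ' - θ‖ < δ ∧ ∀ j < k, ∀ i,
      (∀ x, ‖x‖ ≤ R → 0 < z * (preact ℓ A θ' x (j + 1) i - preact ℓ A θ x (j + 1) i)) ∧
      ∀ᵐ p ∂μ, preact ℓ A θ' p.1 (j + 1) i ∉ S := by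
  have hz0 : z ≠ 0 := by rintro rfl; simp at hz
  have hzabs : |z| = 1 := by
    have : |z| * |z| = 1 := by rw [abs_mul_abs_self, hz]
    nlinarith [abs_nonneg z]
  induction k generalizing δ with
  | zero => exact ⟨θ, by simpa using hδ, by simp⟩
  | succ k ih =>
    have hR' : 0 ≤ max R (‖θ‖ + 1) := le_trans (by positivity) (le_max_right _ _)
    obtain ⟨M, hM, hb⟩ := exists_preact_bound ℓ (paramDim ℓ L) C hR' k
    set u := biasShift ℓ (paramDim ℓ L) k with hu
    obtain ⟨ε, hε, hεu⟩ : ∃ ε : ℝ, 0 < ε ∧ 2 * ε * ‖u‖ < δ / 2 := by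
      refine ⟨δ / (8 * (‖u‖ + 1)), by positivity, ?_⟩
      have h1 : δ / (8 * (‖u‖ + 1)) * (‖u‖ + 1) = δ / 8 := by field_simp
      have h2 : 0 < δ / (8 * (‖u‖ + 1)) := by positivity
      nlinarith
    -- The radius `1` keeps `θ₁` where `M` is valid, `δ / 2` is half of the distance budget, and `ε
    -- / (M + 1)` makes the new layer move by at most `ε`, less than the coming bias shift `t > ε`.
    obtain ⟨θ₁, hθ₁, h₁⟩ := ih (by omega)
      (δ := min (min 1 (δ / 2)) (ε / (M + 1))) (by positivity)
    rw [lt_min_iff, lt_min_iff] at hθ₁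
    obtain ⟨⟨hθ₁1, hθ₁δ⟩, hθ₁ε⟩ := hθ₁
    have hmeas : ∀ i, Measurable fun p : EuclideanSpace ℝ (Fin (ℓ 0)) × Y =>
        preact ℓ A θ₁ p.1 (k + 1) i := fun i =>
      ((continuous_preact_succ ℓ hA.continuous k i).comp
        (Continuous.prodMk_right θ₁)).measurable.comp measurable_fst
    obtain ⟨t, ht, hta⟩ := exists_shift_avoiding (μ := μ) hmeas S hz0
      (show ε < 2 * ε by linarith)
    refine ⟨θ₁ + (t * z) • u, ?_, fun j hj i => ?_⟩
    · have e : θ₁ + (t * z) • u - θ = (θ₁ - θ) + (t * z) • u := by abel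
      have ht0 : 0 < t := hε.trans ht.1
      rw [e]
      refine (norm_add_le _ _).trans_lt ?_
      rw [norm_smul, Real.norm_eq_abs, abs_mul, hzabs, mul_one, abs_of_pos ht0]
      have : t * ‖u‖ ≤ 2 * ε * ‖u‖ := mul_le_mul_of_nonneg_right ht.2.le (norm_nonneg _)
      linarith
    · rcases Nat.lt_succ_iff_lt_or_eq.1 hj with hj | rfl
      · simp only [hu, preact_add_smul_biasShift_of_lt ℓ A θ₁ _ _ hj]
        exact h₁ j hj i
      · simp only [hu, preact_add_smul_biasShift ℓ (show j < L by omega)]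
        refine ⟨fun x hx => ?_, hta i⟩
        have hθn : ‖θ₁‖ ≤ max R (‖θ‖ + 1) := by
          refine le_trans ?_ (le_max_right _ _)
          have := norm_le_norm_add_norm_sub' θ₁ θ
          linarith
        have h2 := (hb A hA x (hx.trans (le_max_left _ _)) θ₁ θ hθn
          (le_trans (by linarith) (le_max_right _ _)) i).2
        have h3 : M * ‖θ₁ - θ‖ ≤ ε := by
          rw [lt_div_iff₀ (by positivity)] at hθ₁ε
          nlinarith [norm_nonneg (θ₁ - θ)]
        have h4 : -(M * ‖θ₁ - θ‖) ≤
            z * (preact ℓ A θ₁ x (j + 1) i - preact ℓ A θ x (j + 1) i) := by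
          have h5 := neg_abs_le (z * (preact ℓ A θ₁ x (j + 1) i - preact ℓ A θ x (j + 1) i))
          rw [abs_mul, hzabs, one_mul] at h5
          linarith
        have h6 : z * (preact ℓ A θ₁ x (j + 1) i + t * z - preact ℓ A θ x (j + 1) i) =
            z * (preact ℓ A θ₁ x (j + 1) i - preact ℓ A θ x (j + 1) i) + t * (z * z) := by ring
        rw [h6, hz, mul_one]
        linarith [ht.1]

/-! ### One-sided continuity of `a` and local bounds on the activations -/

section Activation

variable {S : Finset ℝ} {γ : S → ℝ}

theorem hasDerivAt_genDeriv {f : ℝ → ℝ} (hf : ContDiffOn ℝ 1 f ((S : Set ℝ)ᶜ)) {x : ℝ}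
    (hx : x ∉ S) : HasDerivAt f (genDeriv S γ f x) x := by
  have hmem : ((S : Set ℝ)ᶜ) ∈ 𝓝 x := S.finite_toSet.isClosed.isOpen_compl.mem_nhds (by simpa)
  rw [genDeriv, dif_neg hx]
  exact ((hf.contDiffAt hmem).differentiableAt one_ne_zero).hasDerivAt

theorem continuousAt_genDeriv {f : ℝ → ℝ} (hf : ContDiffOn ℝ 1 f ((S : Set ℝ)ᶜ)) {x : ℝ}
    (hx : x ∉ S) : ContinuousAt (genDeriv S γ f) x := by
  have hopen : IsOpen ((S : Set ℝ)ᶜ) := S.finite_toSet.isClosed.isOpen_compl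
  have hmem : ((S : Set ℝ)ᶜ) ∈ 𝓝 x := hopen.mem_nhds (by simpa)
  have h1 := (hf.continuousOn_deriv_of_isOpen hopen le_rfl).continuousAt hmem
  refine h1.congr ?_
  filter_upwards [hmem] with y hy
  rw [genDeriv, dif_neg (by simpa using hy)]

theorem tendsto_of_oneSidedJump_eq_zero {a : ℝ → ℝ} {z : ℝ} (h : oneSidedJump S a z = 0) {x : ℝ}
    (hx : x ∈ S) : Tendsto (fun t => a (x + z * t)) (𝓝[>] 0) (𝓝 (a x)) := by
  have h1 : limsup (fun t : ℝ => ENNReal.ofReal |a (x + z * t) - a x|) (𝓝[>] (0 : ℝ)) = 0 :=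
    (Finset.sum_eq_zero_iff.1 h) x hx
  have h2 : Tendsto (fun t : ℝ => ENNReal.ofReal |a (x + z * t) - a x|) (𝓝[>] (0 : ℝ)) (𝓝 0) :=
    tendsto_of_le_liminf_of_limsup_le bot_le h1.le
  have h3 := (ENNReal.tendsto_toReal ENNReal.zero_ne_top).comp h2
  rw [tendsto_iff_dist_tendsto_zero]
  simpa [Function.comp_def, Real.dist_eq] using h3

theorem exists_one_sided_continuity {f : ℝ → ℝ} (hf : ContDiffOn ℝ 1 f ((S : Set ℝ)ᶜ))
    (h : min (oneSidedJump S (genDeriv S γ f) (-1)) (oneSidedJump S (genDeriv S γ f) 1) = 0) :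
    ∃ z : ℝ, z * z = 1 ∧
      ∀ x, Tendsto (fun t => genDeriv S γ f (x + z * t)) (𝓝[>] 0) (𝓝 (genDeriv S γ f x)) := by
  obtain ⟨z, hz, hj⟩ : ∃ z : ℝ, z * z = 1 ∧ oneSidedJump S (genDeriv S γ f) z = 0 := by
    rcases min_choice (oneSidedJump S (genDeriv S γ f) (-1))
      (oneSidedJump S (genDeriv S γ f) 1) with h' | h'
    · exact ⟨-1, by norm_num, h' ▸ h⟩
    · exact ⟨1, by norm_num, h' ▸ h⟩
  refine ⟨z, hz, fun x => ?_⟩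
  by_cases hx : x ∈ S
  · exact tendsto_of_oneSidedJump_eq_zero hj hx
  · have h1 : Tendsto (fun t : ℝ => x + z * t) (𝓝[>] 0) (𝓝 x) := by
      have : Continuous fun t : ℝ => x + z * t := by fun_prop
      simpa using (this.tendsto 0).mono_left nhdsWithin_le_nhds
    exact (continuousAt_genDeriv hf hx).tendsto.comp h1

theorem exists_isLocLip {A : ℕ → ℝ → ℝ} (hA : ∀ n, 1 ≤ n → ContDiff ℝ 1 (A n))
    (hconv : ∀ x : ℝ, ∃ m : ℕ, ∀ n, m ≤ n → A n x = A 0 x)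
    (hbdd : ∀ m : ℕ, ∃ C : ℝ, ∀ n, 1 ≤ n → ∀ x ∈ Set.Icc (-(m : ℝ)) (m : ℝ),
      |A n x| + |deriv (A n) x| ≤ C) :
    ∃ C : ℕ → ℝ, ∀ n, IsLocLip C (A n) := by
  choose C hC using hbdd
  have h : ∀ n, 1 ≤ n → IsLocLip C (A n) := by
    intro n hn m x hx
    refine ⟨le_trans (le_add_of_nonneg_right (abs_nonneg _)) (hC m n hn x hx), fun y hy => ?_⟩
    exact (convex_Icc _ _).norm_image_sub_le_of_norm_deriv_le
      (fun u _ => (hA n hn).differentiable one_ne_zero u)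
      (fun u hu => le_trans (le_add_of_nonneg_left (abs_nonneg _)) (hC m n hn u hu)) hy hx
  refine ⟨C, fun n => ?_⟩
  rcases Nat.eq_zero_or_pos n with rfl | hn
  · intro m x hx
    obtain ⟨k, hk⟩ := hconv x
    refine ⟨?_, fun y hy => ?_⟩
    · rw [← hk (max k 1) (le_max_left _ _)]
      exact (h _ (le_max_right _ _) m x hx).1
    · obtain ⟨k', hk'⟩ := hconv y
      rw [← hk (max (max k k') 1) (by simp), ← hk' (max (max k k') 1) (by simp)]
      exact (h _ (le_max_right _ _) m x hx).2 y hy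
  · exact h n hn

end Activation

end ANN

namespace ANN

/-! ### Limits of the formal derivative -/

/-- Only finitely many preactivations occur at fixed `θ` and `x`, so pointwise eventual equality of
the activations suffices, without uniformity. -/
theorem eventually_layerInput_eq (ℓ : ℕ → ℕ) {d : ℕ} {A : ℕ → ℝ → ℝ}
    (hconv : ∀ x : ℝ, ∃ m : ℕ, ∀ n, m ≤ n → A n x = A 0 x) (θ : EuclideanSpace ℝ (Fin d))
    (x : EuclideanSpace ℝ (Fin (ℓ 0))) (k : ℕ) :
    ∀ᶠ n in atTop, layerInput ℓ (A n) θ x k = layerInput ℓ (A 0) θ x k := by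
  induction k with
  | zero => exact Eventually.of_forall fun _ => rfl
  | succ k ih =>
    have h : ∀ᶠ n in atTop, ∀ i,
        A n (preact ℓ (A 0) θ x (k + 1) i) = A 0 (preact ℓ (A 0) θ x (k + 1) i) :=
      eventually_all.2 fun i => eventually_atTop.2 (hconv _)
    filter_upwards [h, ih] with n hn hi
    funext i
    rw [layerInput_succ, layerInput_succ, ← hn i, preact_succ, preact_succ, hi]

theorem eventually_preact_eq (ℓ : ℕ → ℕ) {d : ℕ} {A : ℕ → ℝ → ℝ}
    (hconv : ∀ x : ℝ, ∃ m : ℕ, ∀ n, m ≤ n → A n x = A 0 x) (θ : EuclideanSpace ℝ (Fin d))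
    (x : EuclideanSpace ℝ (Fin (ℓ 0))) (k : ℕ) :
    ∀ᶠ n in atTop, preact ℓ (A n) θ x (k + 1) = preact ℓ (A 0) θ x (k + 1) := by
  filter_upwards [eventually_layerInput_eq ℓ hconv θ x k] with n hn
  rw [preact_succ, preact_succ, hn]

variable {ℓ : ℕ → ℕ} {K : ℕ}
  {H : EuclideanSpace ℝ (Fin (ℓ (K + 1))) × EuclideanSpace ℝ (Fin (paramDim ℓ (K + 1))) ×
      EuclideanSpace ℝ (Fin (ℓ (K + 1))) → ℝ}

theorem tendsto_lossDeriv_activation (hH : ContDiff ℝ 1 H) {A a : ℕ → ℝ → ℝ} {a₀ : ℝ → ℝ}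
    (hconv : ∀ x : ℝ, ∃ m : ℕ, ∀ n, m ≤ n → A n x = A 0 x ∧ a n x = a₀ x)
    (θ : EuclideanSpace ℝ (Fin (paramDim ℓ (K + 1))))
    (p : EuclideanSpace ℝ (Fin (ℓ 0)) × EuclideanSpace ℝ (Fin (ℓ (K + 1)))) :
    Tendsto (fun n => lossDeriv ℓ K H (A n) (a n) θ p) atTop
      (𝓝 (lossDeriv ℓ K H (A 0) a₀ θ p)) := by
  have hconv' : ∀ x : ℝ, ∃ m : ℕ, ∀ n, m ≤ n → A n x = A 0 x := fun x => by
    obtain ⟨m, hm⟩ := hconv x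
    exact ⟨m, fun n hn => (hm n hn).1⟩
  refine tendsto_lossDeriv hH tendsto_const_nhds (fun k _ i => ?_) (fun k _ i => ?_)
  · refine tendsto_nhds_of_eventually_eq ?_
    filter_upwards [eventually_layerInput_eq ℓ hconv' θ p.1 k] with n hn
    rw [hn]
  · refine tendsto_nhds_of_eventually_eq ?_
    filter_upwards [eventually_preact_eq ℓ hconv' θ p.1 k,
      eventually_atTop.2 (hconv (preact ℓ (A 0) θ p.1 (k + 1) i))] with n hn hn'
    rw [hn, hn'.2]

theorem tendsto_lossDeriv_param (hH : ContDiff ℝ 1 H) {A a : ℝ → ℝ} (hA : Continuous A)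
    {z : ℝ} (hz : z * z = 1) (ha : ∀ x, Tendsto (fun t => a (x + z * t)) (𝓝[>] 0) (𝓝 (a x)))
    {θ : ℕ → EuclideanSpace ℝ (Fin (paramDim ℓ (K + 1)))}
    {θ₀ : EuclideanSpace ℝ (Fin (paramDim ℓ (K + 1)))} (hθ : Tendsto θ atTop (𝓝 θ₀))
    {p : EuclideanSpace ℝ (Fin (ℓ 0)) × EuclideanSpace ℝ (Fin (ℓ (K + 1)))}
    (hpos : ∀ n, ∀ k < K, ∀ i,
      0 < z * (preact ℓ A (θ n) p.1 (k + 1) i - preact ℓ A θ₀ p.1 (k + 1) i)) :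
    Tendsto (fun n => lossDeriv ℓ K H A a (θ n) p) atTop (𝓝 (lossDeriv ℓ K H A a θ₀ p)) := by
  refine tendsto_lossDeriv hH hθ (fun k _ i => ?_) (fun k hk i => ?_)
  · exact ((continuous_layerInput ℓ hA k i).tendsto (θ₀, p.1)).comp
      (hθ.prodMk_nhds tendsto_const_nhds)
  · have h1 : Tendsto (fun n => preact ℓ A (θ n) p.1 (k + 1) i) atTop
        (𝓝 (preact ℓ A θ₀ p.1 (k + 1) i)) :=
      ((continuous_preact_succ ℓ hA k i).tendsto (θ₀, p.1)).comp
        (hθ.prodMk_nhds tendsto_const_nhds)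
    -- The signed increments tend to `0` from the right, and `z * z = 1` recovers the preactivation
    -- from them.
    have h2 : Tendsto
        (fun n => z * (preact ℓ A (θ n) p.1 (k + 1) i - preact ℓ A θ₀ p.1 (k + 1) i)) atTop
        (𝓝[>] 0) := by
      refine tendsto_nhdsWithin_iff.2 ⟨?_, Eventually.of_forall fun n => hpos n k hk i⟩
      simpa using (h1.sub_const (preact ℓ A θ₀ p.1 (k + 1) i)).const_mul z
    refine ((ha _).comp h2).congr fun n => ?_
    simp only [Function.comp_apply, ← mul_assoc, hz, one_mul, add_sub_cancel]

end ANN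

/-! ### Identification of the two gradient limits -/

theorem mainTheorem4
    (ℓ : ℕ → ℕ) (hℓ : ∀ k, 0 < ℓ k) (L : ℕ) (hL : 0 < L)
    (S : Finset ℝ) (γ : S → ℝ)
    -- `A 0` is the activation, `A n` for `n ≥ 1` are its continuously differentiable approximations
    (A : ℕ → ℝ → ℝ)
    (hA : ∀ n, 1 ≤ n → ContDiff ℝ 1 (A n))
    (hA0 : ContDiffOn ℝ 1 (A 0) ((S : Set ℝ)ᶜ))
    (hconv : ∀ x : ℝ, ∃ m : ℕ, 1 ≤ m ∧ ∀ n, m ≤ n →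
      A n x = A 0 x ∧ deriv (A n) x = ANN.genDeriv S γ (A 0) x)
    (hbdd : ∀ m : ℕ, ∃ C : ℝ, ∀ n, 1 ≤ n → ∀ x ∈ Set.Icc (-(m : ℝ)) (m : ℝ),
      |A n x| + |deriv (A n) x| ≤ C)
    (hjump : min (ANN.oneSidedJump S (ANN.genDeriv S γ (A 0)) (-1))
      (ANN.oneSidedJump S (ANN.genDeriv S γ (A 0)) 1) = 0)
    (μ : Measure (EuclideanSpace ℝ (Fin (ℓ 0)) × EuclideanSpace ℝ (Fin (ℓ L))))
    [IsFiniteMeasure μ]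
    (hsupp : Bornology.IsBounded
      {x : EuclideanSpace ℝ (Fin (ℓ 0)) | ∃ y, (x, y) ∈ μ.support})
    (H : EuclideanSpace ℝ (Fin (ℓ L)) × EuclideanSpace ℝ (Fin (ANN.paramDim ℓ L)) ×
      EuclideanSpace ℝ (Fin (ℓ L)) → ℝ)
    (hH : ContDiff ℝ 1 H)
    (hint : ∀ n θ, Integrable (fun p => H (ANN.realization ℓ L (A n) θ p.1, θ, p.2)) μ)
    (hgrowth : ∀ r : ℝ, 0 < r →
      ∀ X : EuclideanSpace ℝ (Fin (ℓ L)), (∀ i, |X i| ≤ r) →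
      ∀ Θ : EuclideanSpace ℝ (Fin (ANN.paramDim ℓ L)), (∀ i, |Θ i| ≤ r) →
      ∃ C : ℝ, ∀ z : EuclideanSpace ℝ (Fin (ℓ L)), (∀ i, |z i| ≤ r) →
        ∀ θ : EuclideanSpace ℝ (Fin (ANN.paramDim ℓ L)), (∀ i, |θ i| ≤ r) →
        ∀ x y, (x, y) ∈ μ.support →
          (‖gradient (fun z' => H (z', θ, y)) z‖ + ‖gradient (fun θ' => H (z, θ', y)) θ‖) /
            (1 + |H (X, Θ, y)|) ≤ C)
    (G : EuclideanSpace ℝ (Fin (ANN.paramDim ℓ L)) → EuclideanSpace ℝ (Fin (ANN.paramDim ℓ L)))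
    -- `G θ` is the limit of the gradients at `θ` of the objective functions with activation `A n`
    -- whenever these gradients exist and converge, and arbitrary otherwise
    (hG : ∀ θ w, ∀ v : ℕ → EuclideanSpace ℝ (Fin (ANN.paramDim ℓ L)),
      (∀ n, 1 ≤ n → HasGradientAt (ANN.risk ℓ L H μ (A n)) (v n) θ) →
      Tendsto v atTop (𝓝 w) → G θ = w) :
    ∀ U : Set (EuclideanSpace ℝ (Fin (ANN.paramDim ℓ L))), IsOpen U →
      ContDiffOn ℝ 1 (ANN.risk ℓ L H μ (A 0)) U →
      ∀ θ ∈ U, G θ = gradient (ANN.risk ℓ L H μ (A 0)) θ := by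
  intro U hU hrisk θ hθ
  obtain ⟨K, rfl⟩ : ∃ K, L = K + 1 := ⟨L - 1, by omega⟩
  set a := ANN.genDeriv S γ (A 0) with ha
  have hconv₁ : ∀ x : ℝ, ∃ m : ℕ, ∀ n, m ≤ n → A n x = A 0 x ∧ deriv (A n) x = a x := fun x => by
    obtain ⟨m, _, hm⟩ := hconv x
    exact ⟨m, hm⟩
  obtain ⟨C, hC⟩ := ANN.exists_isLocLip hA (fun x => by
    obtain ⟨m, hm⟩ := hconv₁ x
    exact ⟨m, fun n hn => (hm n hn).1⟩) hbdd
  obtain ⟨B, hB, hlip⟩ := ANN.exists_loss_lipschitz hH hsupp (hC 0) hgrowth θ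
  have hae : ∀ᵐ p ∂μ, p ∈ μ.support := Measure.support_mem_ae
  -- an integrable Lipschitz constant near `θ`, common to all activations
  let b : EuclideanSpace ℝ (Fin (ℓ 0)) × EuclideanSpace ℝ (Fin (ℓ (K + 1))) → ℝ :=
    fun p => B * (1 + |ANN.loss ℓ K H (A 0) θ p|)
  have hb0 : ∀ p, 0 ≤ b p := fun p => by positivity
  have hb : Integrable b μ :=
    ((integrable_const (1 : ℝ)).add (hint 0 θ).abs).const_mul B
  -- Used with `a' = deriv (A n)` for `n ≥ 1` and with `a' = a` for `n = 0`.
  have hder : ∀ n (a' : ℝ → ℝ), ∀ θ' ∈ Metric.ball θ 1,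
      (∀ᵐ p ∂μ, ∀ k < K, ∀ i, HasDerivAt (A n) (a' (ANN.preact ℓ (A n) θ' p.1 (k + 1) i))
        (ANN.preact ℓ (A n) θ' p.1 (k + 1) i)) →
      HasFDerivAt (ANN.risk ℓ (K + 1) H μ (A n)) (∫ p, ANN.lossDeriv ℓ K H (A n) a' θ' p ∂μ) θ' ∧
      AEStronglyMeasurable (ANN.lossDeriv ℓ K H (A n) a' θ') μ ∧
      ∀ᵐ p ∂μ, ‖ANN.lossDeriv ℓ K H (A n) a' θ' p‖ ≤ b p := by
    intro n a' θ' hθ' hd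
    refine ANN.hasFDerivAt_risk hH (hC n).continuous hb0 hb (hint n θ')
      (Metric.isOpen_ball.mem_nhds hθ') ?_ hd
    filter_upwards [hae] with p hp using hlip (A n) (hC n) p hp
  have hG' : G θ = (InnerProductSpace.toDual ℝ _).symm
      (∫ p, ANN.lossDeriv ℓ K H (A 0) a θ p ∂μ) := by
    have h1 : ∀ n, 1 ≤ n → _ := fun n hn => hder n (deriv (A n)) θ (Metric.mem_ball_self one_pos)
      (Eventually.of_forall fun p k _ i => ((hA n hn).differentiable one_ne_zero _).hasDerivAt)
    refine hG θ _ (fun n => (InnerProductSpace.toDual ℝ _).symm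
      (∫ p, ANN.lossDeriv ℓ K H (A n) (deriv (A n)) θ p ∂μ))
      (fun n hn => (h1 n hn).1.hasGradientAt) ?_
    refine ((InnerProductSpace.toDual ℝ _).symm.continuous.tendsto _).comp ?_
    -- The index is shifted because differentiability at `θ` is known only for `n ≥ 1`.
    rw [← tendsto_add_atTop_iff_nat 1]
    refine tendsto_integral_of_dominated_convergence b (fun n => (h1 (n + 1) (by omega)).2.1) hb
      (fun n => (h1 (n + 1) (by omega)).2.2) (Eventually.of_forall fun p => ?_)
    exact (tendsto_add_atTop_iff_nat 1).2
      (ANN.tendsto_lossDeriv_activation (a := fun n => deriv (A n)) hH hconv₁ θ p)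
  rw [hG', gradient]
  congr 1
  obtain ⟨z, hz, hone⟩ := ANN.exists_one_sided_continuity hA0 hjump
  obtain ⟨R, hR⟩ := hsupp.exists_norm_le
  -- Only the `K` hidden layers are perturbed to avoid `S`. The radius is at most `1`, which keeps
  -- the points in the ball where `b` is a Lipschitz constant.
  have hex : ∀ n : ℕ, ∃ θ' : EuclideanSpace ℝ (Fin (ANN.paramDim ℓ (K + 1))),
      ‖θ' - θ‖ < 1 / ((n : ℝ) + 1) ∧ ∀ j < K, ∀ i,
      (∀ x, ‖x‖ ≤ R → 0 < z * (ANN.preact ℓ (A 0) θ' x (j + 1) i -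
        ANN.preact ℓ (A 0) θ x (j + 1) i)) ∧
      ∀ᵐ p ∂μ, ANN.preact ℓ (A 0) θ' p.1 (j + 1) i ∉ S := fun n =>
    ANN.exists_generic_perturbation ℓ (hC 0) S hz R θ (Nat.le_succ K) Nat.one_div_pos_of_nat
  choose φ hφ hφ' using hex
  have hφθ : Tendsto φ atTop (𝓝 θ) := by
    rw [tendsto_iff_norm_sub_tendsto_zero]
    exact squeeze_zero (fun _ => norm_nonneg _) (fun n => (hφ n).le)
      tendsto_one_div_add_atTop_nhds_zero_nat
  have h2 : ∀ n, _ := fun n => hder 0 a (φ n)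
    (mem_ball_iff_norm.2 ((hφ n).trans_le (by
      rw [div_le_one (by positivity)]
      linarith [(Nat.cast_nonneg n : (0 : ℝ) ≤ n)]))) (by
    have h3 : ∀ᵐ p ∂μ, ∀ k : Fin K, ∀ i, ANN.preact ℓ (A 0) (φ n) p.1 (k + 1) i ∉ S :=
      ae_all_iff.2 fun k => ae_all_iff.2 fun i => (hφ' n k k.isLt i).2
    filter_upwards [h3] with p hp k hk i
    exact ANN.hasDerivAt_genDeriv hA0 (hp ⟨k, hk⟩ i))
  have h4 : Tendsto (fun n => ∫ p, ANN.lossDeriv ℓ K H (A 0) a (φ n) p ∂μ) atTop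
      (𝓝 (∫ p, ANN.lossDeriv ℓ K H (A 0) a θ p ∂μ)) := by
    refine tendsto_integral_of_dominated_convergence b (fun n => (h2 n).2.1) hb
      (fun n => (h2 n).2.2) ?_
    filter_upwards [hae] with p hp
    exact ANN.tendsto_lossDeriv_param hH (hC 0).continuous hz hone hφθ
      fun n k hk i => (hφ' n k hk i).1 p.1 (hR p.1 ⟨p.2, hp⟩)
  -- This is where the C¹ assumption on `U` enters.
  have h5 : Tendsto (fun n => fderiv ℝ (ANN.risk ℓ (K + 1) H μ (A 0)) (φ n)) atTop
      (𝓝 (fderiv ℝ (ANN.risk ℓ (K + 1) H μ (A 0)) θ)) :=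
    ((hrisk.continuousOn_fderiv_of_isOpen hU le_rfl).continuousAt (hU.mem_nhds hθ)).tendsto.comp hφθ
  refine tendsto_nhds_unique h4 (h5.congr fun n => (h2 n).1.fderiv)
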